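/- Conventions. A countable Borel equivalence relation (CBER) on a standard Borel space $X$ is an equivalence relation $E$ on $X$ that is Borel as a subset of $X^2$ and all of whose classes are countable. Let $\mathrm{Aut}_B(E)$ be the group of Borel automorphisms $T$ of $X$ such that $x\mathrel{E}y \iff T(x)\mathrel{E}T(y)$ for all $x,y\in X$, let $\mathrm{Inn}_B(E)$ be its normal subgroup of those $T$ with $x\mathrel{E}T(x)$ for all $x\in X$, let $\mathrm{Out}_B(E)=\mathrm{Aut}_B(E)/\mathrm{Inn}_B(E)$, and let $p_E\colon\mathrm{Aut}_B(E)\to\mathrm{Out}_B(E)$ be the quotient morphism. An outer action of a group $G$ is a morphism $\varphi\colon G\to\mathrm{Out}_B(E)$ for some CBER $E$; it lifts if there is a morphism $\psi\colon G\to\mathrm{Aut}_B(E)$ with $p_E\circ\psi=\varphi$. A CBER $E$ on $X$ is treeable if there is an acyclic Borel graph on $X$ whose connected components are exactly the $E$-classes. A countable group $G$ is treeable if there are a standard Borel space $X$, a Borel action of $G$ on $X$ and a $G$-invariant Borel probability measure $\mu$ on $X$ such that the action is free, meaning that for $\mu$-almost every $x$ we have $g\cdot x\neq x$ for all $g\neq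 1$, and such that the orbit equivalence relation $E_G^X$ is treeable. Proposition. Let $G$ be a countable group. If every outer action of $G$ (on every CBER on every standard Borel space) lifts, then $G$ is treeable. -/

import Mathlib

open MeasureTheory

/-- A countable Borel equivalence relation (CBER) on a standard Borel space `X`: an equivalence
relation that is Borel as a subset of `X × X` and all of whose classes are countable. -/
structure CBER (X : Type*) [MeasurableSpace X] [StandardBorelSpace X] extends Setoid X where
  measurableSet_rel : MeasurableSet {p : X × X | toSetoid p.1 p.2}
  countable_class : ∀ x : X, {y : X | toSetoid x y}.Countable

namespace CBER

/-- `Aut_B(E)`: the group, under composition, of Borel automorphisms `T` of `X` such that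
`x E y` if and only if `T x E T y`. -/
def AutB {X : Type*} [MeasurableSpace X] [StandardBorelSpace X] (E : CBER X) :
    Subgroup (Equiv.Perm X) where
  carrier := {T | Measurable (T : X → X) ∧ Measurable (T.symm : X → X) ∧
    ∀ x y : X, E.toSetoid x y ↔ E.toSetoid (T x) (T y)}
  one_mem' := ⟨measurable_id, measurable_id, fun _ _ => Iff.rfl⟩
  mul_mem' := fun {S T} hS hT =>
    ⟨hS.1.comp hT.1, hT.2.1.comp hS.2.1, fun x y => (hT.2.2 x y).trans (hS.2.2 (T x) (T y))⟩
  inv_mem' := fun {T} hT => ⟨hT.2.1, hT.1, fun x y => by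
    have h := hT.2.2 (T.symm x) (T.symm y)
    rw [Equiv.apply_symm_apply, Equiv.apply_symm_apply] at h
    exact h.symm⟩

/-- `Inn_B(E)` (the full group of `E`): the `T` in `Aut_B(E)` with `x E T x` for all `x`. -/
def InnB {X : Type*} [MeasurableSpace X] [StandardBorelSpace X] (E : CBER X) :
    Subgroup E.AutB where
  carrier := {T | ∀ x : X, E.toSetoid x ((T : Equiv.Perm X) x)}
  one_mem' := fun x => E.refl x
  mul_mem' := fun {S T} hS hT x => E.trans (hT x) (hS ((T : Equiv.Perm X) x))
  inv_mem' := fun {T} hT x => by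
    have h := hT ((T : Equiv.Perm X).symm x)
    rw [Equiv.apply_symm_apply] at h
    exact E.symm h

instance InnB_normal {X : Type*} [MeasurableSpace X] [StandardBorelSpace X] (E : CBER X) :
    E.InnB.Normal where
  conj_mem := fun T hT S x => by
    have h := (S.2.2.2 _ _).1 (hT ((S : Equiv.Perm X).symm x))
    rw [Equiv.apply_symm_apply] at h
    exact h

/-- `Out_B(E) = Aut_B(E) / Inn_B(E)`. -/
abbrev OutB {X : Type*} [MeasurableSpace X] [StandardBorelSpace X] (E : CBER X) : Type _ :=
  E.AutB ⧸ E.InnB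

/-- The quotient morphism `p_E : Aut_B(E) → Out_B(E)`. -/
def toOutB {X : Type*} [MeasurableSpace X] [StandardBorelSpace X] (E : CBER X) :
    E.AutB →* E.OutB :=
  QuotientGroup.mk' E.InnB

/-- `E` is treeable: there is an acyclic Borel graph on `X` whose connected components are
exactly the `E`-classes. -/
def Treeable {X : Type*} [MeasurableSpace X] [StandardBorelSpace X] (E : CBER X) : Prop :=
  ∃ Γ : SimpleGraph X, MeasurableSet {p : X × X | Γ.Adj p.1 p.2} ∧ Γ.IsAcyclic ∧
    ∀ x y : X, Γ.Reachable x y ↔ E.toSetoid x y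

/-- The orbit equivalence relation `E_G^X` of a Borel action of a countable group `G` on `X`.
(As `G` is countable, an action is Borel when each element of `G` acts by a Borel map.) -/
def orbit (G : Type*) [Group G] [Countable G] (X : Type*) [MeasurableSpace X]
    [StandardBorelSpace X] [MulAction G X] [MeasurableConstSMul G X] : CBER X where
  toSetoid := MulAction.orbitRel G X
  measurableSet_rel := by
    have h : {p : X × X | MulAction.orbitRel G X p.1 p.2} =
        ⋃ g : G, {p : X × X | g • p.2 = p.1} := by
      ext p
      simp [MulAction.orbitRel_apply, MulAction.mem_orbit_iff]
    rw [h]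
    exact MeasurableSet.iUnion fun g =>
      measurableSet_eq_fun (measurable_snd.const_smul g) measurable_fst
  countable_class := fun x => by
    refine (Set.countable_range fun g : G => g • x).mono fun y hy => ?_
    exact (MulAction.orbitRel G X).symm hy

end CBER

/-- Every outer action of `G` lifts: for every CBER `E` on a standard Borel space, every morphism
`φ : G → Out_B(E)` is of the form `p_E ∘ ψ` for some morphism `ψ : G → Aut_B(E)`. (Every standard
Borel space has a Borel isomorphic copy in the lowest universe.) -/
def EveryOuterActionLifts (G : Type*) [Group G] : Prop :=
  ∀ (X : Type) [MeasurableSpace X] [StandardBorelSpace X] (E : CBER X) (φ : G →* E.OutB),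
    ∃ ψ : G →* E.AutB, E.toOutB.comp ψ = φ

/-- A countable group `G` is treeable: it has a Borel action on a standard Borel space `X` with an
invariant Borel probability measure `μ`, free on `μ`-almost all points, such that the orbit
equivalence relation on `X` is treeable. -/
def TreeableGroup (G : Type*) [Group G] [Countable G] : Prop :=
  ∃ (X : Type) (_ : MeasurableSpace X) (_ : StandardBorelSpace X) (_ : MulAction G X)
    (_ : MeasurableConstSMul G X) (μ : Measure X),
    IsProbabilityMeasure μ ∧ SMulInvariantMeasure G X μ ∧
    (∀ᵐ x ∂μ, ∀ g : G, g ≠ 1 → g • x ≠ x) ∧ (CBER.orbit G X).Treeable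

/-! Write G as a quotient of a free group F of countable rank by N, and let F act freely and
preserving a probability measure on X. F normalizes the orbit relation of N and N acts by inner
automorphisms, so G acts outerly on that relation. A lift gives a genuine action in which each g
moves each point by some preimage of g in F (`EveryOuterActionLifts.exists_action`). Hence it is
free, since only 1 in F fixes a point; it preserves the measure, being piecewise given by elements
of F (`measure_preimage_of_mem_orbit`); and its orbits lie inside F-orbits.

The F-orbits carry the acyclic Schreier graph (`freeSchreierGraph_isAcyclic`), and treeability
passes to Borel subrelations (`CBER.treeable_of_reachable`): for each subclass, contract every
vertex of the ambient tree to a point of the subclass chosen by a shortest path. -/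

/-! ### Nearest points of a class -/

/-- The endpoint of the path that starts at a point and applies the maps `e i` in the order listed. -/
def runWord {ι X : Type*} (e : ι → X → X) : List ι → X → X
  | [], y => y
  | i :: l, y => runWord e l (e i y)

theorem measurable_runWord {ι X : Type*} [MeasurableSpace X] {e : ι → X → X}
    (he : ∀ i, Measurable (e i)) : ∀ l, Measurable (runWord e l)
  | [] => measurable_id
  | i :: l => (measurable_runWord he l).comp (he i)

theorem runWord_append {ι X : Type*} (e : ι → X → X) (l m : List ι) (y : X) :
    runWord e (l ++ m) y = runWord e m (runWord e l y) := by
  induction l generalizing y with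
  | nil => rfl
  | cons i l ih => exact ih (e i y)

/-- `z` is the endpoint of the shortlex-least path leading from `y` to the class of `x`. -/
def IsNearestPoint {ι X : Type*} (e : ι → X → X) (r : Setoid X) (x y z : X) : Prop :=
  ∃ l, runWord e l y = z ∧ r x z ∧
    ∀ m, r x (runWord e m y) → ¬ List.Shortlex WellOrderingRel m l

namespace IsNearestPoint

variable {ι X : Type*} {e : ι → X → X} {r : Setoid X} {x x' y z w : X}

theorem rel (h : IsNearestPoint e r x y z) : r x z := by
  obtain ⟨l, -, h, -⟩ := h
  exact h

theorem unique (h : IsNearestPoint e r x y z) (h' : IsNearestPoint e r x y w) : z = w := by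
  obtain ⟨l, rfl, hl, hmin⟩ := h
  obtain ⟨m, rfl, hm, hmin'⟩ := h'
  rw [Std.Trichotomous.trichotomous (r := List.Shortlex (WellOrderingRel (α := ι))) l m
    (hmin' l hl) (hmin m hm)]

theorem congr (hx : r x x') (h : IsNearestPoint e r x y z) : IsNearestPoint e r x' y z := by
  obtain ⟨l, rfl, hl, hmin⟩ := h
  exact ⟨l, rfl, r.trans (r.symm hx) hl, fun m hm => hmin m (r.trans hx hm)⟩

theorem of_rel (h : r x y) : IsNearestPoint e r x y y :=
  ⟨[], rfl, h, fun _ _ => List.not_shortlex_nil_right⟩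

theorem exists_of_runWord {l : List ι} (h : r x (runWord e l y)) :
    ∃ z, IsNearestPoint e r x y z := by
  have wf : WellFounded (List.Shortlex (WellOrderingRel (α := ι))) :=
    List.Shortlex.wf WellOrderingRel.isWellOrder.wf
  obtain ⟨m, hm, hmin⟩ := wf.has_min {l | r x (runWord e l y)} ⟨l, h⟩
  exact ⟨_, m, rfl, hm, hmin⟩

/-- Prepending a letter is monotone for shortlex, so suffixes of a least word are least. All
vertices on the path thus share the nearest point z, which makes the fibres of the contraction
connected. -/
theorem exists_path (h : IsNearestPoint e r x y z) :
    ∃ l, runWord e l y = z ∧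
      ∀ l₁ l₂, l = l₁ ++ l₂ → IsNearestPoint e r x (runWord e l₁ y) z := by
  obtain ⟨l, hl, hz, hmin⟩ := h
  refine ⟨l, hl, fun l₁ => ?_⟩
  induction l₁ generalizing y l with
  | nil => exact fun _ _ => ⟨l, hl, hz, hmin⟩
  | cons i l₁ ih =>
    rintro l₂ rfl
    exact ih (l₁ ++ l₂) hl
      (fun m hm hlt => hmin (i :: m) hm (List.Shortlex.cons hlt)) l₂ rfl

end IsNearestPoint

theorem measurableSet_isNearestPoint {ι X Y : Type*} [Countable ι] [MeasurableSpace X]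
    [MeasurableSpace Y] [MeasurableEq X] {e : ι → X → X} (he : ∀ i, Measurable (e i))
    {r : Setoid X} (hr : MeasurableSet {p : X × X | r p.1 p.2}) {f g k : Y → X}
    (hf : Measurable f) (hg : Measurable g) (hk : Measurable k) :
    MeasurableSet {p : Y | IsNearestPoint e r (f p) (g p) (k p)} := by
  have hrel {u v : Y → X} (hu : Measurable u) (hv : Measurable v) :
      MeasurableSet {p | r (u p) (v p)} := (hu.prodMk hv) hr
  simp only [IsNearestPoint, Set.ofPred_exists]
  refine MeasurableSet.iUnion fun l => ?_
  refine (measurableSet_eq_fun ((measurable_runWord he l).comp hg) hk).inter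
    ((hrel hf hk).inter ?_)
  change MeasurableSet {p | ∀ m, _}
  rw [Set.ofPred_forall]
  refine MeasurableSet.iInter fun m => ?_
  by_cases h : List.Shortlex WellOrderingRel m l
  · simp only [h, not_true_eq_false, imp_false]
    exact (hrel hf ((measurable_runWord he m).comp hg)).compl
  · simp [h]

/-! ### Contracting a forest onto a subrelation -/

/-- The graph obtained by contracting, for each class of `r`, the points nearest to a given element
of the class to that element. -/
def contractedGraph {ι X : Type*} (e : ι → X → X) (T : SimpleGraph X) (r : Setoid X) :
    SimpleGraph X where
  Adj x x' := x ≠ x' ∧ ∃ y y', T.Adj y y' ∧ IsNearestPoint e r x y x ∧ IsNearestPoint e r x y' x'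
  symm := ⟨by
    rintro x x' ⟨hne, y, y', hadj, h, h'⟩
    exact ⟨hne.symm, y', y, hadj.symm, h'.congr h'.rel, h.congr h'.rel⟩⟩
  loopless := ⟨fun _ h => h.1 rfl⟩

section Contraction

variable {ι X : Type*} {e : ι → X → X} {T : SimpleGraph X} {r : Setoid X}

theorem exists_runWord_of_reachable (hadj : ∀ x y, T.Adj x y → ∃ i, e i x = y) {x y : X}
    (h : T.Reachable x y) : ∃ l, runWord e l x = y := by
  rw [SimpleGraph.reachable_iff_reflTransGen] at h
  induction h with
  | refl => exact ⟨[], rfl⟩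
  | tail _ hyz ih =>
    obtain ⟨l, rfl⟩ := ih
    obtain ⟨i, hi⟩ := hadj _ _ hyz
    exact ⟨l ++ [i], by rw [runWord_append]; exact hi⟩

/-- Only the edges actually traversed need to survive in `S`; this is applied to `T` itself and to
`T` with an edge deleted. Letters that fix the current point are idle steps. -/
theorem reachable_runWord (hadj : ∀ i x, e i x ≠ x → T.Adj x (e i x)) (S : SimpleGraph X)
    (l : List ι) (y : X)
    (hS : ∀ l₁ i l₂, l = l₁ ++ i :: l₂ → T.Adj (runWord e l₁ y) (e i (runWord e l₁ y)) →
      S.Adj (runWord e l₁ y) (e i (runWord e l₁ y))) :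
    S.Reachable y (runWord e l y) := by
  induction l generalizing y with
  | nil => exact SimpleGraph.Reachable.refl _
  | cons i l ih =>
    refine SimpleGraph.Reachable.trans ?_
      (ih (e i y) fun l₁ j l₂ h => hS (i :: l₁) j l₂ (by rw [h]; rfl))
    by_cases h : e i y = y
    · rw [h]
    · exact (hS [] i l rfl (hadj i y h)).reachable

theorem contractedGraph_rel_of_reachable {x y : X} (h : (contractedGraph e T r).Reachable x y) :
    r x y := by
  rw [SimpleGraph.reachable_iff_reflTransGen] at h
  induction h with
  | refl => exact r.refl x
  | tail _ hyz ih =>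
    obtain ⟨-, _, _, -, -, h⟩ := hyz
    exact r.trans ih h.rel

/-- Along a `T`-path from x to x', the nearest points of consecutive vertices are equal or adjacent.
-/
theorem contractedGraph_reachable (hadj : ∀ x y, T.Adj x y → ∃ i, e i x = y)
    (hr : ∀ x y, r x y → T.Reachable x y) {x x' : X} (h : r x x') :
    (contractedGraph e T r).Reachable x x' := by
  have key : ∀ y, T.Reachable x y → ∀ c, IsNearestPoint e r x y c →
      (contractedGraph e T r).Reachable x c := by
    intro y hy
    rw [SimpleGraph.reachable_iff_reflTransGen] at hy
    induction hy with
    | refl =>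
      intro c hc
      rw [hc.unique (.of_rel (r.refl x))]
    | @tail y z hxy hyz ih =>
      intro c hc
      obtain ⟨l, hl⟩ := exists_runWord_of_reachable hadj
        ((SimpleGraph.reachable_iff_reflTransGen _ _).2 hxy).symm
      obtain ⟨d, hd⟩ := IsNearestPoint.exists_of_runWord (e := e) (r := r) (x := x) (y := y)
        (l := l) (by rw [hl])
      refine (ih d hd).trans ?_
      by_cases hdc : d = c
      · rw [hdc]
      · exact SimpleGraph.Adj.reachable ⟨hdc, y, z, hyz, hd.congr hd.rel, hc.congr hd.rel⟩
  exact key x' (hr x x' h) x' (.of_rel h)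

/-- Let the edge xx' come from the edge yy' of `T`. Paths within a fibre of the contraction never
cross yy', whose ends lie in different fibres. A detour from x to x' avoiding xx' would therefore
lift to a detour from y to y' avoiding yy', but yy' is a bridge. -/
theorem contractedGraph_isAcyclic (hT : T.IsAcyclic)
    (hadj : ∀ i x, e i x ≠ x → T.Adj x (e i x)) : (contractedGraph e T r).IsAcyclic := by
  rw [SimpleGraph.isAcyclic_iff_forall_adj_isBridge] at hT ⊢
  rintro x x' ⟨hne, y, y', hyy', hx, hx'⟩
  rw [SimpleGraph.isBridge_iff]
  intro hreach
  have hbridge := hT hyy'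
  rw [SimpleGraph.isBridge_iff] at hbridge
  set S := T.deleteEdges {s(y, y')} with hS
  have fibre {u c : X} (h : IsNearestPoint e r x u c) : S.Reachable u c := by
    obtain ⟨l, rfl, hl⟩ := h.exists_path
    refine reachable_runWord hadj S l u fun l₁ i l₂ hl' hadj' => ?_
    rw [hS, SimpleGraph.deleteEdges_adj]
    refine ⟨hadj', fun heq => hne ?_⟩
    have h₁ := hl l₁ (i :: l₂) hl'
    have h₂ := hl (l₁ ++ [i]) l₂ (by simp [hl'])
    rw [runWord_append] at h₂
    change IsNearestPoint e r x (e i (runWord e l₁ u)) _ at h₂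
    rw [Set.mem_singleton_iff, Sym2.eq_iff] at heq
    rcases heq with ⟨ha, hb⟩ | ⟨ha, hb⟩ <;> rw [ha] at h₁ <;> rw [hb] at h₂
    · exact (hx.unique h₁).trans (h₂.unique hx')
    · exact (hx.unique h₂).trans (h₁.unique hx')
  refine hbridge (((fibre hx).trans ?_).trans (fibre hx').symm)
  rw [SimpleGraph.reachable_iff_reflTransGen] at hreach
  -- The relation `r x c` is carried along so that nearest points taken with respect to c can be
  -- compared with those for x.
  have key : ∀ c, Relation.ReflTransGen
      ((contractedGraph e T r).deleteEdges {s(x, x')}).Adj x c → S.Reachable x c ∧ r x c := by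
    intro c hc
    induction hc with
    | refl => exact ⟨.refl _, r.refl x⟩
    | @tail c d _ hcd ih =>
      obtain ⟨hreach, hrel⟩ := ih
      rw [SimpleGraph.deleteEdges_adj] at hcd
      obtain ⟨⟨hcd, z, z', hzz', hz, hz'⟩, hne'⟩ := hcd
      replace hz := hz.congr (r.symm hrel)
      replace hz' := hz'.congr (r.symm hrel)
      refine ⟨hreach.trans (((fibre hz).symm.trans (SimpleGraph.Adj.reachable ?_)).trans
        (fibre hz')), hz'.rel⟩
      rw [hS, SimpleGraph.deleteEdges_adj]
      refine ⟨hzz', fun heq => hne' ?_⟩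
      rw [Set.mem_singleton_iff, Sym2.eq_iff] at heq ⊢
      rcases heq with ⟨rfl, rfl⟩ | ⟨rfl, rfl⟩
      · exact .inl ⟨hz.unique hx, hz'.unique hx'⟩
      · exact .inr ⟨hz.unique hx', hz'.unique hx⟩
  exact (key x' hreach).1

end Contraction

/-- A countable Borel equivalence relation contained in the connectedness relation of an acyclic
graph whose edges are given by countably many Borel maps is treeable. -/
theorem CBER.treeable_of_reachable {X : Type*} [MeasurableSpace X] [StandardBorelSpace X]
    {ι : Type*} [Countable ι] {e : ι → X → X} (he : ∀ i, Measurable (e i))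
    {T : SimpleGraph X} (hT : T.IsAcyclic) (hadj : ∀ x y, T.Adj x y ↔ x ≠ y ∧ ∃ i, e i x = y)
    (E : CBER X) (hE : ∀ x y, E.toSetoid x y → T.Reachable x y) : E.Treeable := by
  refine ⟨contractedGraph e T E.toSetoid, ?_,
    contractedGraph_isAcyclic hT fun i x h => (hadj _ _).2 ⟨h.symm, i, rfl⟩,
    fun x y => ⟨contractedGraph_rel_of_reachable,
      contractedGraph_reachable (fun x y h => ((hadj x y).1 h).2) hE⟩⟩
  -- An edge of `T` inducing one at `p.1` lies in the `T`-component of `p.1`, so words starting at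
  -- `p.1` name its ends. This turns quantifiers over X into countable unions.
  have heq : {p : X × X | (contractedGraph e T E.toSetoid).Adj p.1 p.2} =
      {p | p.1 = p.2}ᶜ ∩ ⋃ (l : List ι) (i : ι),
        {p | runWord e l p.1 = e i (runWord e l p.1)}ᶜ ∩
        ({p | IsNearestPoint e E.toSetoid p.1 (runWord e l p.1) p.1} ∩
          {p | IsNearestPoint e E.toSetoid p.1 (e i (runWord e l p.1)) p.2}) := by
    ext p
    simp only [contractedGraph, Set.mem_inter_iff, Set.mem_compl_iff, Set.mem_ofPred_eq,
      Set.mem_iUnion]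
    refine and_congr_right fun _ => ⟨?_, ?_⟩
    · rintro ⟨y, y', hyy', h, h'⟩
      have hreach : T.Reachable y p.1 := by
        obtain ⟨l, hl, -⟩ := h
        rw [← hl]
        exact reachable_runWord (fun i x h => (hadj _ _).2 ⟨h.symm, i, rfl⟩) T l y
          fun _ _ _ _ h => h
      obtain ⟨l, rfl⟩ := exists_runWord_of_reachable
        (fun x y h => ((hadj x y).1 h).2) hreach.symm
      obtain ⟨hne, i, rfl⟩ := (hadj _ _).1 hyy'
      exact ⟨l, i, hne, h, h'⟩
    · rintro ⟨l, i, hne, h, h'⟩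
      exact ⟨_, _, (hadj _ _).2 ⟨hne, i, rfl⟩, h, h'⟩
  rw [heq]
  have hw (l) : Measurable fun p : X × X => runWord e l p.1 :=
    (measurable_runWord he l).comp measurable_fst
  refine (measurableSet_eq_fun measurable_fst measurable_snd).compl.inter
    (MeasurableSet.iUnion fun l => MeasurableSet.iUnion fun i => ?_)
  refine (measurableSet_eq_fun (hw l) ((he i).comp (hw l))).compl.inter (.inter ?_ ?_)
  · exact measurableSet_isNearestPoint he E.measurableSet_rel measurable_fst (hw l) measurable_fst
  · exact measurableSet_isNearestPoint he E.measurableSet_rel measurable_fst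
      ((he i).comp (hw l)) measurable_snd

/-! ### Schreier graphs of free actions of free groups -/

/-- The Schreier graph of an action of a free group, with respect to the free generators. -/
def freeSchreierGraph (α X : Type*) [MulAction (FreeGroup α) X] : SimpleGraph X where
  Adj x y := x ≠ y ∧ ∃ s : α × Bool, FreeGroup.mk [s] • x = y
  symm := ⟨by
    rintro x _ ⟨hne, s, rfl⟩
    refine ⟨hne.symm, (s.1, !s.2), ?_⟩
    rw [← mul_smul, show (FreeGroup.mk [(s.1, !s.2)] : FreeGroup α) = (FreeGroup.mk [s])⁻¹ by simp
      [FreeGroup.inv_mk, FreeGroup.invRev], inv_mul_cancel, one_smul]⟩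
  loopless := ⟨fun _ h => h.1 rfl⟩

theorem freeSchreierGraph_reachable_smul {α X : Type*} [MulAction (FreeGroup α) X]
    (f : FreeGroup α) (x : X) : (freeSchreierGraph α X).Reachable x (f • x) := by
  classical
  rw [← FreeGroup.mk_toWord (x := f)]
  induction f.toWord with
  | nil => rw [← FreeGroup.one_eq_mk, one_smul]
  | cons s l ih =>
    refine ih.trans ?_
    rw [← List.singleton_append, ← FreeGroup.mul_mk, mul_smul]
    by_cases h : FreeGroup.mk l • x = FreeGroup.mk [s] • FreeGroup.mk l • x
    · rw [← h]
    · exact SimpleGraph.Adj.reachable ⟨h, s, rfl⟩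

/-- Left multiplication by a letter preserves the last letter of a reduced word, unless the word or
the product is trivial. -/
theorem FreeGroup.getLast?_toWord_mk_singleton_mul {α : Type*} [DecidableEq α] (s : α × Bool)
    (w : FreeGroup α) (hw : w ≠ 1) (hsw : FreeGroup.mk [s] * w ≠ 1) :
    (FreeGroup.mk [s] * w).toWord.getLast? = w.toWord.getLast? := by
  have hcons : (FreeGroup.mk [s] * w).toWord = FreeGroup.reduce (s :: w.toWord) := by
    rw [← FreeGroup.toWord_mk, ← List.singleton_append (l := w.toWord), ← FreeGroup.mul_mk,
      FreeGroup.mk_toWord]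
  rw [Ne, ← FreeGroup.toWord_eq_nil_iff] at hw hsw
  rw [FreeGroup.reduce.cons, FreeGroup.reduce_toWord] at hcons
  rw [hcons] at hsw ⊢
  clear hcons
  generalize w.toWord = l at *
  match l, hw with
  | t :: l, _ =>
    dsimp only at hsw ⊢
    split_ifs at hsw ⊢ with h
    · match l, hsw with
      | u :: l, _ => simp
    · simp

/-- Once the edge from y to s • y is deleted, a walk from y only visits points w • y whose reduced
word w does not end in s: the last letter is fixed when leaving w = 1, and leaving by s is
forbidden. By freeness, s • y is not such a point. -/
theorem freeSchreierGraph_isAcyclic {α X : Type*} [MulAction (FreeGroup α) X]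
    (hfree : ∀ (f : FreeGroup α) (x : X), f • x = x → f = 1) :
    (freeSchreierGraph α X).IsAcyclic := by
  classical
  have hinj {f g : FreeGroup α} {x : X} (h : f • x = g • x) : f = g := by
    have := hfree (g⁻¹ * f) x (by rw [mul_smul, h, inv_smul_smul])
    exact (inv_mul_eq_one.1 this).symm
  rw [SimpleGraph.isAcyclic_iff_forall_adj_isBridge]
  rintro y _ ⟨hne, s, rfl⟩
  rw [SimpleGraph.isBridge_iff, SimpleGraph.reachable_iff_reflTransGen]
  intro hreach
  have key : ∀ z, Relation.ReflTransGen
      ((freeSchreierGraph α X).deleteEdges {s(y, FreeGroup.mk [s] • y)}).Adj y z →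
      ∃ w : FreeGroup α, z = w • y ∧ w.toWord.getLast? ≠ some s := by
    intro z hz
    induction hz with
    | refl => exact ⟨1, (one_smul _ y).symm, by simp⟩
    | tail _ hadj ih =>
      obtain ⟨w, rfl, hw⟩ := ih
      rw [SimpleGraph.deleteEdges_adj] at hadj
      obtain ⟨⟨-, t, rfl⟩, hdel⟩ := hadj
      refine ⟨FreeGroup.mk [t] * w, (mul_smul _ _ _).symm, ?_⟩
      by_cases h1 : w = 1
      · subst h1
        simp only [one_smul, Set.mem_singleton_iff] at hdel
        rw [mul_one, FreeGroup.toWord_mk, FreeGroup.reduce_singleton]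
        rintro ⟨⟩
        exact hdel rfl
      · by_cases h2 : FreeGroup.mk [t] * w = 1
        · simp [h2]
        · rwa [FreeGroup.getLast?_toWord_mk_singleton_mul t w h1 h2]
  obtain ⟨w, hw, hlast⟩ := key _ hreach
  rw [← hinj hw] at hlast
  simp [FreeGroup.toWord_mk] at hlast

/-! ### A free measure-preserving action -/

/-- The injective labellings of a group by points of the unit interval, on which the group acts
freely by shift. -/
abbrev InjLabelling (Γ : Type*) : Type _ := ↥{x : Γ → unitInterval | Function.Injective x}

theorem measurableSet_injective (Γ : Type*) [Countable Γ] :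
    MeasurableSet {x : Γ → unitInterval | Function.Injective x} := by
  have h : {x : Γ → unitInterval | Function.Injective x} =
      ⋂ (a : Γ) (b : Γ) (_ : a ≠ b), {x | x a = x b}ᶜ := by
    ext x
    simp only [Set.mem_ofPred_eq, Set.mem_iInter, Set.mem_compl_iff, Function.Injective]
    exact forall₂_congr fun a b => not_imp_not.symm
  rw [h]
  exact .iInter fun a => .iInter fun b => .iInter fun _ =>
    (measurableSet_eq_fun (measurable_pi_apply a) (measurable_pi_apply b)).compl

instance (Γ : Type*) [Countable Γ] : StandardBorelSpace (InjLabelling Γ) :=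
  (measurableSet_injective Γ).standardBorel

instance (Γ : Type*) [Group Γ] : MulAction Γ (InjLabelling Γ) where
  smul g x := ⟨fun h => x.1 (g⁻¹ * h), Function.Injective.comp x.2 (mul_right_injective g⁻¹)⟩
  one_smul x := Subtype.ext (funext fun h => by
    change x.1 (1⁻¹ * h) = x.1 h
    rw [inv_one, one_mul])
  mul_smul f g x := Subtype.ext (funext fun h => by
    change x.1 ((f * g)⁻¹ * h) = x.1 (g⁻¹ * (f⁻¹ * h))
    rw [mul_inv_rev, mul_assoc])

namespace InjLabelling

/-- Injectivity of the labels gives freeness at every point, so no null set has to be discarded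
later. -/
theorem eq_one_of_smul_eq {Γ : Type*} [Group Γ] {g : Γ} {x : InjLabelling Γ} (h : g • x = x) : g = 1 := by
  have h1 : x.1 (g⁻¹ * 1) = x.1 1 := congrFun (congrArg Subtype.val h) 1
  simpa using x.2 h1

instance {Γ : Type*} [Group Γ] : MeasurableConstSMul Γ (InjLabelling Γ) where
  measurable_const_smul g := by
    have h : Measurable fun (x : InjLabelling Γ) h => x.1 (g⁻¹ * h) :=
      measurable_pi_lambda _ fun h => (measurable_pi_apply (g⁻¹ * h)).comp measurable_subtype_coe
    exact h.subtype_mk (h := fun x => (g • x).2)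

/-- The restriction of the product of Lebesgue measures to the injective labellings. -/
noncomputable def measure (Γ : Type*) : Measure (InjLabelling Γ) :=
  (Measure.infinitePi fun _ : Γ => (volume : Measure unitInterval)).comap Subtype.val

/-- Two distinct coordinates are independent with atomless law, so they agree with probability zero;
there are countably many pairs. -/
theorem ae_injective {Γ : Type*} [Countable Γ] :
    ∀ᵐ x ∂Measure.infinitePi fun _ : Γ => (volume : Measure unitInterval),
      Function.Injective x := by
  have h : ∀ a b : Γ, ∀ᵐ x ∂Measure.infinitePi fun _ : Γ => (volume : Measure unitInterval),
      x a = x b → a = b := by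
    intro a b
    by_cases hab : a = b
    · exact .of_forall fun _ _ => hab
    have hdiag : MeasurableSet {p : unitInterval × unitInterval | p.1 = p.2} :=
      measurableSet_eq_fun measurable_fst measurable_snd
    rw [ae_iff]
    simp only [hab, imp_false, not_not]
    change (Measure.infinitePi fun _ : Γ => (volume : Measure unitInterval))
      ((fun x => (x a, x b)) ⁻¹' {p : unitInterval × unitInterval | p.1 = p.2}) = 0
    rw [← Measure.map_apply (by fun_prop) hdiag, Measure.infinitePi_map_eval_prod hab,
      Measure.measure_prod_null hdiag]
    refine .of_forall fun u => ?_
    change volume {v | u = v} = 0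
    simp [Set.ofPred_eq_eq_singleton']
  filter_upwards [ae_all_iff.2 fun a => ae_all_iff.2 (h a)] with x hx a b hab using hx a b hab

theorem measure_apply {Γ : Type*} [Countable Γ] (s : Set (Γ → unitInterval)) :
    measure Γ (Subtype.val ⁻¹' s) =
      Measure.infinitePi (fun _ : Γ => (volume : Measure unitInterval)) s := by
  rw [measure, comap_subtype_coe_apply (measurableSet_injective Γ),
    Subtype.image_preimage_coe, Set.inter_comm]
  refine measure_inter_conull ?_
  exact ae_iff.1 ae_injective

instance (Γ : Type*) [Countable Γ] : IsProbabilityMeasure (measure Γ) where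
  measure_univ := by
    rw [← Set.preimage_univ (f := Subtype.val), measure_apply, measure_univ]

instance (Γ : Type*) [Group Γ] [Countable Γ] : SMulInvariantMeasure Γ (InjLabelling Γ) (measure Γ) where
  measure_preimage_smul g s hs := by
    obtain ⟨t, ht, rfl⟩ := hs
    have hshift : Measurable fun (x : Γ → unitInterval) h => x (g⁻¹ * h) := by fun_prop
    have h := Measure.map_infinitePi_infinitePi_of_inj
      (P := fun _ : Γ => (volume : Measure unitInterval)) (mul_right_injective g⁻¹)
    rw [measure_apply, ← h, Measure.map_apply hshift ht, ← measure_apply]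
    rfl

end InjLabelling

/-! ### From a lift to an action -/

/-- A Borel automorphism that moves each point within its orbit under a free measure-preserving
action of a countable group preserves the measure. -/
theorem measure_preimage_of_mem_orbit {Γ X : Type*} [Group Γ] [Countable Γ] [MeasurableSpace X]
    [MeasurableEq X] [MulAction Γ X] [MeasurableConstSMul Γ X] {μ : Measure X}
    [SMulInvariantMeasure Γ X μ] (hfree : ∀ (f : Γ) (x : X), f • x = x → f = 1)
    {T : Equiv.Perm X} (hT : Measurable T) (hT' : Measurable T.symm)
    (horb : ∀ x, ∃ f : Γ, T x = f • x) {s : Set X} (hs : MeasurableSet s) :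
    μ (T ⁻¹' s) = μ s := by
  have hinj {f g : Γ} {x : X} (h : f • x = g • x) : f = g :=
    (inv_mul_eq_one.1 (hfree (g⁻¹ * f) x (by rw [mul_smul, h, inv_smul_smul]))).symm
  -- `T` agrees with f on `A f`, and `B f` is the image of `A f` under f. By freeness, the sets `A
  -- f` partition X, and so do the sets `B f`.
  set A : Γ → Set X := fun f => {x | T x = f • x} with hA
  set B : Γ → Set X := fun f => {z | T.symm z = f⁻¹ • z} with hB
  have hAm f : MeasurableSet (A f) := measurableSet_eq_fun hT (measurable_const_smul f)
  have hBm f : MeasurableSet (B f) := measurableSet_eq_fun hT' (measurable_const_smul f⁻¹)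
  have hAd : Pairwise (Function.onFun Disjoint A) := fun f g hfg =>
    Set.disjoint_left.2 fun x hf hg => hfg (hinj (hf.symm.trans hg))
  have hBd : Pairwise (Function.onFun Disjoint B) := fun f g hfg =>
    Set.disjoint_left.2 fun x hf hg => hfg (inv_injective (hinj (hf.symm.trans hg)))
  have hAu : T ⁻¹' s = ⋃ f, T ⁻¹' s ∩ A f := by
    rw [← Set.inter_iUnion, show ⋃ f, A f = Set.univ from Set.iUnion_eq_univ_iff.2 horb,
      Set.inter_univ]
  have hBu : s = ⋃ f, s ∩ B f := by
    rw [← Set.inter_iUnion, Set.iUnion_eq_univ_iff.2, Set.inter_univ]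
    intro z
    obtain ⟨f, hf⟩ := horb (T.symm z)
    rw [Equiv.apply_symm_apply] at hf
    exact ⟨f, by rw [hB, Set.mem_ofPred_eq, eq_inv_smul_iff, hf.symm]⟩
  have hAB f : T ⁻¹' s ∩ A f = (f • ·) ⁻¹' (s ∩ B f) := by
    ext x
    have : x ∈ A f ↔ f • x ∈ B f := by
      simp only [hA, hB, Set.mem_ofPred_eq, inv_smul_smul, Equiv.symm_apply_eq]
      exact eq_comm
    constructor
    · rintro ⟨h, h'⟩
      exact ⟨Set.mem_of_eq_of_mem (show T x = f • x from h').symm h, this.1 h'⟩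
    · rintro ⟨h, h'⟩
      exact ⟨show T x ∈ s from Set.mem_of_eq_of_mem (this.2 h') h, this.2 h'⟩
  rw [hAu, measure_iUnion (fun f g h => (hAd h).mono Set.inter_subset_right Set.inter_subset_right)
    fun f => (hT hs).inter (hAm f)]
  conv_rhs => rw [hBu]
  rw [measure_iUnion (fun f g h => (hBd h).mono Set.inter_subset_right Set.inter_subset_right)
    fun f => hs.inter (hBm f)]
  exact tsum_congr fun f => by rw [hAB, measure_preimage_smul]

/-- The action of a group by automorphisms of the orbit equivalence relation of a normal
subgroup. -/
def CBER.normalizerAction {Γ X : Type*} [Group Γ] [Countable Γ] [MeasurableSpace X]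
    [StandardBorelSpace X] [MulAction Γ X] [MeasurableConstSMul Γ X] (N : Subgroup Γ) [N.Normal]
    [MeasurableConstSMul N X] : Γ →* (CBER.orbit N X).AutB :=
  (MulAction.toPermHom Γ X).codRestrict _ fun f => by
    have h : ∀ (f : Γ) (x y : X), MulAction.orbitRel N X x y →
        MulAction.orbitRel N X (f • x) (f • y) := by
      rintro f _ y ⟨n, rfl⟩
      refine ⟨⟨f * n * f⁻¹, Subgroup.Normal.conj_mem inferInstance (n : Γ) n.2 f⟩, ?_⟩
      change (f * n * f⁻¹) • f • y = f • (n : Γ) • y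
      rw [mul_smul, inv_smul_smul, mul_smul]
    refine ⟨measurable_const_smul f, measurable_const_smul f⁻¹, fun x y => ⟨h f x y, fun hxy => ?_⟩⟩
    have := h f⁻¹ _ _ hxy
    change MulAction.orbitRel N X (f⁻¹ • f • x) (f⁻¹ • f • y) at this
    rwa [inv_smul_smul, inv_smul_smul] at this

/-- If every outer action of `G` lifts, and `G` is the image of a countable group `Γ` acting on a
standard Borel space `X`, then there is a Borel action of `G` on `X` in which every `g` moves each
point by some preimage of `g` in `Γ`. -/
theorem EveryOuterActionLifts.exists_action {G Γ : Type*} {X : Type} [Group G] [Group Γ]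
    [Countable Γ] [MeasurableSpace X] [StandardBorelSpace X] [MulAction Γ X]
    [MeasurableConstSMul Γ X] (h : EveryOuterActionLifts G) {π : Γ →* G}
    (hπ : Function.Surjective π) :
    ∃ ψ : G →* Equiv.Perm X, (∀ g, Measurable (ψ g)) ∧
      ∀ g x, ∃ f : Γ, π f = g ∧ ψ g x = f • x := by
  have : MeasurableConstSMul π.ker X := ⟨fun n => measurable_const_smul (n : Γ)⟩
  let E := CBER.orbit π.ker X
  let τ : Γ →* E.AutB := CBER.normalizerAction π.ker
  -- Elements of the kernel move points within their own `E`-classes, so the outer action descends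
  -- to G.
  have hker : π.ker ≤ (E.toOutB.comp τ).ker := by
    intro n hn
    rw [MonoidHom.mem_ker, MonoidHom.comp_apply]
    refine (QuotientGroup.eq_one_iff _).2 fun x => ?_
    exact E.symm ⟨⟨n, hn⟩, rfl⟩
  obtain ⟨ψ, hψ⟩ := h X E ((QuotientGroup.lift π.ker (E.toOutB.comp τ) hker).comp
    (QuotientGroup.quotientKerEquivOfSurjective π hπ).symm.toMonoidHom)
  refine ⟨E.AutB.subtype.comp ψ, fun g => (ψ g).2.1, fun g x => ?_⟩
  obtain ⟨f, rfl⟩ := hπ g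
  have hf : E.toOutB (τ f) = E.toOutB (ψ (π f)) := by
    have hq : (QuotientGroup.quotientKerEquivOfSurjective π hπ).symm (π f) = (f : Γ ⧸ π.ker) := by
      rw [MulEquiv.symm_apply_eq]
      rfl
    have := DFunLike.congr_fun hψ (π f)
    rw [MonoidHom.comp_apply] at this
    rw [this]
    change _ = QuotientGroup.lift π.ker (E.toOutB.comp τ) hker
      ((QuotientGroup.quotientKerEquivOfSurjective π hπ).symm (π f))
    rw [hq]
    rfl
  -- The lift differs from f by an inner automorphism, so at x there is n in the kernel with n • f⁻¹
  -- • ψ(π f) x = x. Thus f * n⁻¹ is the required preimage, and n depends on x.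
  obtain ⟨n, hn⟩ := QuotientGroup.eq.1 hf x
  refine ⟨f * (n : Γ)⁻¹, by rw [map_mul, map_inv, MonoidHom.mem_ker.1 n.2, inv_one, mul_one], ?_⟩
  change (n : Γ) • f⁻¹ • (ψ (π f) : Equiv.Perm X) x = x at hn
  rw [mul_smul, ← inv_smul_eq_iff, ← smul_eq_iff_eq_inv_smul]
  exact hn

theorem proposition1p4 (G : Type*) [Group G] [Countable G]
    (h : EveryOuterActionLifts G) : TreeableGroup G := by
  obtain ⟨u, hu⟩ := exists_surjective_nat G
  let π : FreeGroup ℕ →* G := FreeGroup.lift u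
  have hπ : Function.Surjective π := fun g => by
    obtain ⟨n, rfl⟩ := hu g
    exact ⟨FreeGroup.of n, FreeGroup.lift_apply_of⟩
  have : Countable (FreeGroup ℕ) := FreeGroup.toWord_injective.countable
  let X := InjLabelling (FreeGroup ℕ)
  obtain ⟨ψ, hψm, hψ⟩ := h.exists_action (X := X) hπ
  let : MulAction G X := MulAction.compHom X ψ
  have hsmul (g : G) (x : X) : g • x = ψ g x := rfl
  have : MeasurableConstSMul G X := ⟨hψm⟩
  refine ⟨X, inferInstance, inferInstance, inferInstance, inferInstance,
    InjLabelling.measure (FreeGroup ℕ), inferInstance, ⟨fun g s hs => ?_⟩, ?_, ?_⟩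
  · refine measure_preimage_of_mem_orbit (Γ := FreeGroup ℕ) (T := ψ g)
      (fun _ _ => InjLabelling.eq_one_of_smul_eq) (hψm g) ?_ (fun x => ?_) hs
    · have := hψm g⁻¹
      rwa [map_inv] at this
    · obtain ⟨f, -, hf⟩ := hψ g x
      exact ⟨f, hf⟩
  · refine .of_forall fun x g hg hx => hg ?_
    obtain ⟨f, rfl, hf⟩ := hψ g x
    rw [InjLabelling.eq_one_of_smul_eq (hf.symm.trans hx), map_one]
  · refine CBER.treeable_of_reachable
      (e := fun (s : ℕ × Bool) (x : X) => (FreeGroup.mk [s] : FreeGroup ℕ) • x)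
      (fun s => measurable_const_smul _)
      (freeSchreierGraph_isAcyclic fun _ _ => InjLabelling.eq_one_of_smul_eq)
      (fun _ _ => Iff.rfl) _ ?_
    rintro _ y ⟨g, rfl⟩
    obtain ⟨f, -, hf⟩ := hψ g y
    change (freeSchreierGraph ℕ X).Reachable (ψ g y) y
    rw [hf]
    exact (freeSchreierGraph_reachable_smul f y).symm
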